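/- Throughout, $A$ is a partially ordered set with a top element $\top$ and a bottom element $\bot$. The games over $A$ are defined inductively: every $a\in A$ gives an atomic game $[a]$ (with no options), and if $L,R$ are non-empty sets of games, then $\{L\,|\,R\}$ is a (composite) game with left options $L$ and right options $R$. We write $\top,\bot$ also for the games $[\top],[\bot]$. Relations $\le$ and $\lhd$ on games are defined by mutual recursion: - $G\le H$ iff every left option $G^L$ of $G$ satisfies $G^L\lhd H$, every right option $H^R$ of $H$ satisfies $G\lhd H^R$, and, if $G$ or $H$ is atomic, $G\lhd H$; - $G\lhd H$ iff some right option $G^R$ of $G$ satisfies $G^R\le H$, or some left option $H^L$ of $H$ satisfies $G\le H^L$, or $G=[a]$ and $H=[b]$ are atomic with $a\le b$. Games $G,H$ are equivalent if $G\le H$ and $H\le G$. A monotone set coloring game $S$ over $A$ consists of a finite set $|S|$ of cells (the carrier) and a monotone payoff function $\pi_S:\{\bot,\top\}^{|S|}\to A$ (pointwise order, $\bot<\top$). A position is a map $p:|S|\to\{\top,\bot,\star\}$, where $\star$ marks an empty cell. It determines a game $[\![p]\!]$ over $A$: if no cell is empty, $[\![p]\!]=[\pi_S(p)]$; otherwise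 the left (respectively right) options of $[\![p]\!]$ are the games $[\![p']\!]$, where $p'$ is obtained from $p$ by coloring exactly one empty cell with $\top$ (respectively $\bot$). The game of $S$ is $[\![p_0]\!]$ for the position $p_0$ in which all cells are empty. A game $G$ over $A$ is realizable with size $n$ if $G$ is equivalent to the game of some monotone set coloring game over $A$ whose carrier has exactly $n$ elements. **Proposition 4.1.** Let $G$ and $H$ be games over $A$ that are realizable with size $p$ and $q$, respectively. Then (a) $\{\top\,|\,G\}$ and $\{G\,|\,\bot\}$ are each realizable with size $p+1$; (b) the choice gadget $\{\{\top|G\},\{\top|H\}\,|\,\{G|\bot\},\{H|\bot\}\}$ is realizable with size $\max\{p,q\}+2$; (c) the coupling gadget $\{G,\{\top|H\}\,|\,\{G|\bot\},H\}$ is realizable with size $p+q+5$. -/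

import Mathlib

universe u v

/-- Combinatorial games over a set `A` of atoms. A game is either an atomic game `[a]` or a
composite game `{L | R}` with non-empty collections `L`, `R` of left and right options. As usual
for combinatorial games in type theory, the collections of options are (small) indexed families;
order and equivalence below depend only on the sets of options. -/
inductive PosetGame (A : Type u) : Type (max u (v + 1))
  | atom (a : A) : PosetGame A
  | comp (ι κ : Type v) [Nonempty ι] [Nonempty κ]
      (L : ι → PosetGame A) (R : κ → PosetGame A) : PosetGame A

namespace PosetGame

/-- The set of left options; atomic games have none. -/
def leftOptions {A : Type u} : PosetGame.{u, v} A → Set (PosetGame.{u, v} A)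
  | atom _ => ∅
  | comp _ _ L _ => Set.range L

/-- The set of right options; atomic games have none. -/
def rightOptions {A : Type u} : PosetGame.{u, v} A → Set (PosetGame.{u, v} A)
  | atom _ => ∅
  | comp _ _ _ R => Set.range R

/-- The game is of the form `[a]`. -/
def IsAtomic {A : Type u} (G : PosetGame.{u, v} A) : Prop := ∃ a : A, G = atom a

mutual

/-- The order `G ≤ H` on games (simultaneously with `Tri`). The defining clauses decrease along
options, so that the least relations closed under them are the ones defined by recursion; see
`le_iff` and `tri_iff`. -/
inductive Le {A : Type u} [PartialOrder A] : PosetGame.{u, v} A → PosetGame.{u, v} A → Prop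
  | intro {G H : PosetGame.{u, v} A}
      (left : ∀ G' ∈ G.leftOptions, Tri G' H)
      (right : ∀ H' ∈ H.rightOptions, Tri G H')
      (atomic : G.IsAtomic ∨ H.IsAtomic → Tri G H) : Le G H

/-- The relation `G ⊲ H` on games (simultaneously with `Le`). -/
inductive Tri {A : Type u} [PartialOrder A] : PosetGame.{u, v} A → PosetGame.{u, v} A → Prop
  | right {G H G' : PosetGame.{u, v} A} (mem : G' ∈ G.rightOptions) (le : Le G' H) : Tri G H
  | left {G H H' : PosetGame.{u, v} A} (mem : H' ∈ H.leftOptions) (le : Le G H') : Tri G H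
  | atom {a b : A} (le : a ≤ b) : Tri (PosetGame.atom a) (PosetGame.atom b)

end

theorem le_iff {A : Type u} [PartialOrder A] {G H : PosetGame.{u, v} A} :
    Le G H ↔ (∀ G' ∈ G.leftOptions, Tri G' H) ∧ (∀ H' ∈ H.rightOptions, Tri G H') ∧
      (G.IsAtomic ∨ H.IsAtomic → Tri G H) :=
  ⟨fun h => by cases h with | intro h₁ h₂ h₃ => exact ⟨h₁, h₂, h₃⟩,
    fun h => Le.intro h.1 h.2.1 h.2.2⟩

theorem tri_iff {A : Type u} [PartialOrder A] {G H : PosetGame.{u, v} A} :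
    Tri G H ↔ (∃ G' ∈ G.rightOptions, Le G' H) ∨ (∃ H' ∈ H.leftOptions, Le G H') ∨
      (∃ a b : A, G = PosetGame.atom a ∧ H = PosetGame.atom b ∧ a ≤ b) := by
  constructor
  · intro h
    cases h with
    | right m h => exact Or.inl ⟨_, m, h⟩
    | left m h => exact Or.inr (Or.inl ⟨_, m, h⟩)
    | atom h => exact Or.inr (Or.inr ⟨_, _, rfl, rfl, h⟩)
  · rintro (⟨_, m, h⟩ | ⟨_, m, h⟩ | ⟨a, b, rfl, rfl, h⟩)
    · exact Tri.right m h
    · exact Tri.left m h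
    · exact Tri.atom h

/-- Equivalence of games: `G ≤ H` and `H ≤ G`. -/
def Equivalent {A : Type u} [PartialOrder A] (G H : PosetGame.{u, v} A) : Prop :=
  Le G H ∧ Le H G

/-- The game `{G | H}` with one left and one right option. -/
def single {A : Type u} (G H : PosetGame.{u, v} A) : PosetGame.{u, v} A :=
  comp PUnit PUnit (fun _ => G) (fun _ => H)

/-- The game `{G₁, G₂ | H₁, H₂}`. -/
def pair {A : Type u} (G₁ G₂ H₁ H₂ : PosetGame.{u, v} A) : PosetGame.{u, v} A :=
  comp (ULift Bool) (ULift Bool)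
    (fun i => if i.down then G₂ else G₁) (fun i => if i.down then H₂ else H₁)

theorem leftOptions_single {A : Type u} (G H : PosetGame.{u, v} A) :
    (single G H).leftOptions = {G} := by
  simp [single, leftOptions]

theorem rightOptions_single {A : Type u} (G H : PosetGame.{u, v} A) :
    (single G H).rightOptions = {H} := by
  simp [single, rightOptions]

theorem leftOptions_pair {A : Type u} (G₁ G₂ H₁ H₂ : PosetGame.{u, v} A) :
    (pair G₁ G₂ H₁ H₂).leftOptions = {G₁, G₂} := by
  ext x
  constructor
  · rintro ⟨⟨i⟩, rfl⟩
    cases i <;> simp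
  · rintro (rfl | rfl)
    · exact ⟨⟨false⟩, by simp⟩
    · exact ⟨⟨true⟩, by simp⟩

theorem rightOptions_pair {A : Type u} (G₁ G₂ H₁ H₂ : PosetGame.{u, v} A) :
    (pair G₁ G₂ H₁ H₂).rightOptions = {H₁, H₂} := by
  ext x
  constructor
  · rintro ⟨⟨i⟩, rfl⟩
    cases i <;> simp
  · rintro (rfl | rfl)
    · exact ⟨⟨false⟩, by simp⟩
    · exact ⟨⟨true⟩, by simp⟩

/-- Left forcing gadget `{⊤ | G}`. -/
def leftForcing {A : Type u} [PartialOrder A] [BoundedOrder A] (G : PosetGame.{u, v} A) :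
    PosetGame.{u, v} A :=
  single (atom ⊤) G

/-- Right forcing gadget `{G | ⊥}`. -/
def rightForcing {A : Type u} [PartialOrder A] [BoundedOrder A] (G : PosetGame.{u, v} A) :
    PosetGame.{u, v} A :=
  single G (atom ⊥)

/-- Choice gadget `{{⊤ | G}, {⊤ | H} | {G | ⊥}, {H | ⊥}}`. -/
def choiceGadget {A : Type u} [PartialOrder A] [BoundedOrder A] (G H : PosetGame.{u, v} A) :
    PosetGame.{u, v} A :=
  pair (leftForcing G) (leftForcing H) (rightForcing G) (rightForcing H)

/-- Coupling gadget `{G, {⊤ | H} | {G | ⊥}, H}`. -/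
def couplingGadget {A : Type u} [PartialOrder A] [BoundedOrder A] (G H : PosetGame.{u, v} A) :
    PosetGame.{u, v} A :=
  pair G (leftForcing H) (rightForcing G) H

end PosetGame

/-- A monotone set coloring game over `A`: a finite carrier of cells and a monotone payoff function
from the colorings of the cells by booleans (`true` for Left, `false` for Right, with
`false < true` and the pointwise order) to `A`. -/
structure SetColoringGame (A : Type u) [PartialOrder A] where
  carrier : Type v
  finite_carrier : Finite carrier
  payoff : (carrier → Bool) → A
  monotone_payoff : Monotone payoff

namespace SetColoringGame

/-- The size of a set coloring game: the number of its cells. -/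
noncomputable def size {A : Type u} [PartialOrder A] (S : SetColoringGame.{u, v} A) : ℕ :=
  Nat.card S.carrier

/-- A position: each cell has color `some true` (Left), `some false` (Right) or is empty
(`none`). -/
abbrev Position {A : Type u} [PartialOrder A] (S : SetColoringGame.{u, v} A) : Type v :=
  S.carrier → Option Bool

open Classical in
/-- The position obtained from `p` by coloring the cell `c` with the color `b`. -/
noncomputable def color {A : Type u} [PartialOrder A] (S : SetColoringGame.{u, v} A)
    (p : S.Position) (c : S.carrier) (b : Bool) : S.Position :=
  Function.update p c (some b)

theorem ncard_color_lt {A : Type u} [PartialOrder A] (S : SetColoringGame.{u, v} A)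
    (p : S.Position) (c : S.carrier) (hc : p c = none) (b : Bool) :
    {x | S.color p c b x = none}.ncard < {x | p x = none}.ncard := by
  classical
  have := S.finite_carrier
  apply Set.ncard_lt_ncard _ (Set.toFinite _)
  refine ⟨fun x hx => ?_, fun h => ?_⟩
  · by_cases hxc : x = c
    · subst hxc; exact hc
    · simpa [color, hxc] using hx
  · have := h (show c ∈ {x | p x = none} from hc)
    simp [color] at this

open Classical in
/-- The combinatorial game associated with a position `p`. If `p` has an empty cell, its left
(right) options are the games of the positions obtained from `p` by coloring one empty cell with
Left's (Right's) color. Otherwise the game is atomic, given by the payoff of the coloring `p` (the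
default value of `getD` is then never used). -/
noncomputable def sem {A : Type u} [PartialOrder A] (S : SetColoringGame.{u, v} A)
    (p : S.Position) : PosetGame.{u, v} A :=
  if h : Nonempty {c : S.carrier // p c = none} then
    PosetGame.comp {c : S.carrier // p c = none} {c : S.carrier // p c = none}
      (fun c => S.sem (S.color p c.1 true)) (fun c => S.sem (S.color p c.1 false))
  else
    PosetGame.atom (S.payoff fun c => (p c).getD false)
termination_by {c | p c = none}.ncard
decreasing_by
  · exact S.ncard_color_lt p c.1 c.2 true
  · exact S.ncard_color_lt p c.1 c.2 false

/-- The combinatorial game of `S`: that of its all-empty initial position. -/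
noncomputable def value {A : Type u} [PartialOrder A] (S : SetColoringGame.{u, v} A) :
    PosetGame.{u, v} A :=
  S.sem fun _ => none

end SetColoringGame

/-- `G` is realizable with size `n`: it is equivalent to the game of some monotone set coloring
game with exactly `n` cells. -/
def PosetGame.RealizableWithSize {A : Type u} [PartialOrder A] (G : PosetGame.{u, v} A)
    (n : ℕ) : Prop :=
  ∃ S : SetColoringGame.{u, v} A, S.size = n ∧ G.Equivalent S.value


/-!
Each gadget is `P` with `G` and `H` substituted for its atoms, where `P` is the same gadget over the
four outcomes `Bool × Bool`: `(true, false)` stands for `G`, `(false, true)` for `H`, and the two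
extreme outcomes for wins by Left and by Right. Let `C` be a set coloring game with these outcomes
and value `≤ P`, and let `S` and `T` realize `G` and `H`. One plays `C` alongside `S` and `T`, and
its outcome decides which of the two payoffs counts. The value of the combined game is at most the
gadget as soon as Right has an answer to every move of Left in the cells of `S` and `T`. In the
choice gadget it suffices to answer the move in `S` alone, so that `S` and `T` may share their
cells; in the coupling gadget there is an answer if the move affects only one of `S` and `T`, so
that their cells have to be disjoint. The opposite inequality is the same statement for the opposite
poset.
-/

namespace PosetGame

variable {A : Type u} {B : Type*}

theorem options_induction {motive : PosetGame.{u, v} A → Prop}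
    (step : ∀ G : PosetGame.{u, v} A, (∀ G' ∈ G.leftOptions, motive G') →
      (∀ G' ∈ G.rightOptions, motive G') → motive G) (G : PosetGame.{u, v} A) : motive G := by
  induction G with
  | atom a => exact step _ (by simp [leftOptions]) (by simp [rightOptions])
  | comp ι κ L R ihL ihR =>
    exact step _ (Set.forall_mem_range.2 ihL) (Set.forall_mem_range.2 ihR)

theorem forall_leftOptions_single {motive : PosetGame.{u, v} A → Prop} {G H : PosetGame.{u, v} A} :
    (∀ K ∈ (single G H).leftOptions, motive K) ↔ motive G := by
  simp only [leftOptions_single, Set.mem_singleton_iff, forall_eq]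

theorem forall_rightOptions_single {motive : PosetGame.{u, v} A → Prop}
    {G H : PosetGame.{u, v} A} :
    (∀ K ∈ (single G H).rightOptions, motive K) ↔ motive H := by
  simp only [rightOptions_single, Set.mem_singleton_iff, forall_eq]

theorem forall_leftOptions_pair {motive : PosetGame.{u, v} A → Prop}
    {G₁ G₂ H₁ H₂ : PosetGame.{u, v} A} :
    (∀ K ∈ (pair G₁ G₂ H₁ H₂).leftOptions, motive K) ↔ motive G₁ ∧ motive G₂ := by
  simp only [leftOptions_pair, Set.mem_insert_iff, Set.mem_singleton_iff, forall_eq_or_imp,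
    forall_eq]

theorem forall_rightOptions_pair {motive : PosetGame.{u, v} A → Prop}
    {G₁ G₂ H₁ H₂ : PosetGame.{u, v} A} :
    (∀ K ∈ (pair G₁ G₂ H₁ H₂).rightOptions, motive K) ↔ motive H₁ ∧ motive H₂ := by
  simp only [rightOptions_pair, Set.mem_insert_iff, Set.mem_singleton_iff, forall_eq_or_imp,
    forall_eq]

theorem not_isAtomic_single (G H : PosetGame.{u, v} A) : ¬ (single G H).IsAtomic := nofun

theorem not_isAtomic_pair (G₁ G₂ H₁ H₂ : PosetGame.{u, v} A) :
    ¬ (pair G₁ G₂ H₁ H₂).IsAtomic := nofun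

/-- Substitution of games for the atoms of a game. -/
def bind : PosetGame.{_, v} B → (B → PosetGame.{u, v} A) → PosetGame.{u, v} A
  | atom b, f => f b
  | comp ι κ L R, f => comp ι κ (fun i => (L i).bind f) (fun j => (R j).bind f)

theorem pair_bind (G₁ G₂ H₁ H₂ : PosetGame.{_, v} B) (f : B → PosetGame.{u, v} A) :
    (pair G₁ G₂ H₁ H₂).bind f =
      pair (G₁.bind f) (G₂.bind f) (H₁.bind f) (H₂.bind f) := by
  simp only [pair, bind, apply_ite (bind · f)]

theorem mem_leftOptions_bind {P P' : PosetGame.{_, v} B}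
    (hP' : P' ∈ P.leftOptions) (f : B → PosetGame.{u, v} A) :
    P'.bind f ∈ (P.bind f).leftOptions := by
  cases P with
  | atom b => exact absurd hP' (Set.notMem_empty _)
  | comp ι κ L R => exact hP'.imp fun i hi => congrArg (bind · f) hi

section Order

variable [PartialOrder A] {G G' H H' K : PosetGame.{u, v} A}

theorem Le.tri_left (h : Le G H) (hG' : G' ∈ G.leftOptions) : Tri G' H := (le_iff.1 h).1 _ hG'

theorem Le.tri_right (h : Le G H) (hH' : H' ∈ H.rightOptions) : Tri G H' :=
  (le_iff.1 h).2.1 _ hH'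

theorem Le.tri_of_isAtomic (h : Le G H) (hGH : G.IsAtomic ∨ H.IsAtomic) : Tri G H :=
  (le_iff.1 h).2.2 hGH

theorem Le.refl (G : PosetGame.{u, v} A) : Le G G := by
  induction G using options_induction with
  | step G ihL ihR =>
    refine .intro (fun G' hG' => .left hG' (ihL _ hG')) (fun G' hG' => .right hG' (ihR _ hG')) ?_
    rintro (⟨a, rfl⟩ | ⟨a, rfl⟩) <;> exact .atom le_rfl

theorem Le.of_eq (h : G = H) : Le G H := h ▸ .refl G

theorem atom_le_atom {a b : A} (h : a ≤ b) : Le (atom a : PosetGame.{u, v} A) (atom b) :=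
  .intro (by simp [leftOptions]) (by simp [rightOptions]) fun _ => .atom h

theorem Tri.exists_leftOption {a : A} (h : Tri (PosetGame.atom a) H) :
    (∃ H' ∈ H.leftOptions, Le (PosetGame.atom a) H') ∨ ∃ b, H = PosetGame.atom b ∧ a ≤ b := by
  cases h with
  | right hG' => exact absurd hG' (Set.notMem_empty _)
  | left hH' h => exact .inl ⟨_, hH', h⟩
  | atom h => exact .inr ⟨_, rfl, h⟩

theorem Tri.exists_rightOption {b : A} (h : Tri G (PosetGame.atom b)) :
    (∃ G' ∈ G.rightOptions, Le G' (PosetGame.atom b)) ∨ ∃ a, G = PosetGame.atom a ∧ a ≤ b := by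
  cases h with
  | right hG' h => exact .inl ⟨_, hG', h⟩
  | left hH' => exact absurd hH' (Set.notMem_empty _)
  | atom h => exact .inr ⟨_, rfl, h⟩

theorem tri_trans_le_and_le_trans_tri_and_le_trans (G H K : PosetGame.{u, v} A) :
    (Tri G H → Le H K → Tri G K) ∧ (Le G H → Tri H K → Tri G K) ∧
      (Le G H → Le H K → Le G K) := by
  induction G using options_induction generalizing H K with | step G ihGL ihGR
  induction H using options_induction generalizing K with | step H ihHL ihHR
  induction K using options_induction with | step K ihKL ihKR
  have tri_le : Tri G H → Le H K → Tri G K := by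
    intro hGH hHK
    cases hGH with
    | right hG' h => exact .right hG' ((ihGR _ hG' H K).2.2 h hHK)
    | left hH' h => exact (ihHL _ hH' K).2.1 h (hHK.tri_left hH')
    | atom hab =>
      obtain ⟨K', hK', h⟩ | ⟨c, rfl, hbc⟩ := (hHK.tri_of_isAtomic (.inl ⟨_, rfl⟩)).exists_leftOption
      · exact .left hK' ((ihKL _ hK').2.2 (atom_le_atom hab) h)
      · exact .atom (hab.trans hbc)
  have le_tri : Le G H → Tri H K → Tri G K := by
    intro hGH hHK
    cases hHK with
    | right hH' h => exact (ihHR _ hH' K).1 (hGH.tri_right hH') h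
    | left hK' h => exact .left hK' ((ihKL _ hK').2.2 hGH h)
    | atom hbc =>
      obtain ⟨G', hG', h⟩ | ⟨a, rfl, hab⟩ :=
        (hGH.tri_of_isAtomic (.inr ⟨_, rfl⟩)).exists_rightOption
      · exact .right hG' ((ihGR _ hG' _ _).2.2 h (atom_le_atom hbc))
      · exact .atom (hab.trans hbc)
  refine ⟨tri_le, le_tri, fun hGH hHK => .intro
    (fun G' hG' => (ihGL _ hG' _ _).1 (hGH.tri_left hG') hHK)
    (fun K' hK' => (ihKR _ hK').2.1 hGH (hHK.tri_right hK')) ?_⟩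
  rintro (hG | hK)
  · exact tri_le (hGH.tri_of_isAtomic (.inl hG)) hHK
  · exact le_tri hGH (hHK.tri_of_isAtomic (.inr hK))

theorem Tri.trans_le (hGH : Tri G H) (hHK : Le H K) : Tri G K :=
  (tri_trans_le_and_le_trans_tri_and_le_trans G H K).1 hGH hHK

theorem Le.trans_tri (hGH : Le G H) (hHK : Tri H K) : Tri G K :=
  (tri_trans_le_and_le_trans_tri_and_le_trans G H K).2.1 hGH hHK

theorem Le.trans (hGH : Le G H) (hHK : Le H K) : Le G K :=
  (tri_trans_le_and_le_trans_tri_and_le_trans G H K).2.2 hGH hHK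

theorem single_le_single (hG : Le G G') (hH : Le H H') : Le (single G H) (single G' H') := by
  refine .intro (forall_leftOptions_single.2 ?_) (forall_rightOptions_single.2 ?_)
    (by simp only [not_isAtomic_single, or_self, false_imp_iff])
  · exact .left (by simp [leftOptions_single]) hG
  · exact .right (by simp [rightOptions_single]) hH

theorem pair_le_pair {G₁ G₂ H₁ H₂ G₁' G₂' H₁' H₂' : PosetGame.{u, v} A} (hG₁ : Le G₁ G₁')
    (hG₂ : Le G₂ G₂') (hH₁ : Le H₁ H₁') (hH₂ : Le H₂ H₂') :
    Le (pair G₁ G₂ H₁ H₂) (pair G₁' G₂' H₁' H₂') := by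
  refine .intro (forall_leftOptions_pair.2 ?_) (forall_rightOptions_pair.2 ?_)
    (by simp only [not_isAtomic_pair, or_self, false_imp_iff])
  · exact ⟨.left (by simp [leftOptions_pair]) hG₁, .left (by simp [leftOptions_pair]) hG₂⟩
  · exact ⟨.right (by simp [rightOptions_pair]) hH₁, .right (by simp [rightOptions_pair]) hH₂⟩

theorem pair_le_pair_swap (G₁ G₂ H₁ H₂ : PosetGame.{u, v} A) :
    Le (pair G₁ G₂ H₁ H₂) (pair G₂ G₁ H₂ H₁) := by
  refine .intro ?_ ?_ (by simp only [not_isAtomic_pair, or_self, false_imp_iff])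
  · exact fun K hK => .left (by simpa [leftOptions_pair, or_comm] using hK) (.refl K)
  · exact fun K hK => .right (by simpa [rightOptions_pair, or_comm] using hK) (.refl K)

end Order

section Dual

/-- The dual game over the opposite poset, in which the two players exchange roles. -/
def dual : PosetGame.{u, v} A → PosetGame.{u, v} Aᵒᵈ
  | atom a => atom (OrderDual.toDual a)
  | comp ι κ L R => comp κ ι (fun j => (R j).dual) (fun i => (L i).dual)

theorem leftOptions_dual (G : PosetGame.{u, v} A) :
    G.dual.leftOptions = dual '' G.rightOptions := by
  cases G with
  | atom a => exact (Set.image_empty _).symm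
  | comp => exact Set.range_comp _ _

theorem rightOptions_dual (G : PosetGame.{u, v} A) :
    G.dual.rightOptions = dual '' G.leftOptions := by
  cases G with
  | atom a => exact (Set.image_empty _).symm
  | comp => exact Set.range_comp _ _

theorem isAtomic_dual {G : PosetGame.{u, v} A} : G.dual.IsAtomic ↔ G.IsAtomic := by
  cases G with
  | atom a => exact iff_of_true ⟨_, rfl⟩ ⟨_, rfl⟩
  | comp => exact iff_of_false nofun nofun

theorem dual_pair (G₁ G₂ H₁ H₂ : PosetGame.{u, v} A) :
    (pair G₁ G₂ H₁ H₂).dual = pair H₁.dual H₂.dual G₁.dual G₂.dual := by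
  simp only [pair, dual, apply_ite dual]

variable [PartialOrder A]

theorem le_of_dual_and_tri_of_dual (G H : PosetGame.{u, v} A) :
    (Le H.dual G.dual → Le G H) ∧ (Tri H.dual G.dual → Tri G H) := by
  induction G using options_induction generalizing H with | step G ihGL ihGR
  induction H using options_induction with | step H ihHL ihHR
  have tri : Tri H.dual G.dual → Tri G H := by
    intro h
    obtain ⟨H', hH', h⟩ | ⟨G', hG', h⟩ | ⟨b, a, hb, ha, hab⟩ := tri_iff.1 h
    · rw [rightOptions_dual] at hH'
      obtain ⟨H', hH', rfl⟩ := hH'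
      exact .left hH' ((ihHL H' hH').1 h)
    · rw [leftOptions_dual] at hG'
      obtain ⟨G', hG', rfl⟩ := hG'
      exact .right hG' ((ihGR G' hG' H).1 h)
    · obtain ⟨a, rfl⟩ := isAtomic_dual.1 ⟨_, ha⟩
      obtain ⟨b, rfl⟩ := isAtomic_dual.1 ⟨_, hb⟩
      cases ha
      cases hb
      exact .atom hab
  refine ⟨fun h => .intro (fun G' hG' => (ihGL G' hG' H).2 (h.tri_right ?_))
    (fun H' hH' => (ihHR H' hH').2 (h.tri_left ?_))
    fun hGH => tri (h.tri_of_isAtomic ?_), tri⟩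
  · exact rightOptions_dual G ▸ Set.mem_image_of_mem _ hG'
  · exact leftOptions_dual H ▸ Set.mem_image_of_mem _ hH'
  · rwa [isAtomic_dual, isAtomic_dual, or_comm]

theorem le_of_dual_le_dual {G H : PosetGame.{u, v} A} (h : Le H.dual G.dual) : Le G H :=
  (le_of_dual_and_tri_of_dual G H).1 h

end Dual

section Gadgets

variable [PartialOrder A] [BoundedOrder A] {G G' H H' K : PosetGame.{u, v} A}

theorem le_atom_top (G : PosetGame.{u, v} A) : Le G (atom ⊤) := by
  induction G with
  | atom a => exact atom_le_atom le_top
  | comp ι κ L R ihL ihR =>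
    have tri : Tri (comp ι κ L R) (atom ⊤) :=
      .right (Set.mem_range_self (Classical.arbitrary κ)) (ihR _)
    refine .intro (Set.forall_mem_range.2 fun i => ?_) nofun fun _ => tri
    exact (ihL i).tri_of_isAtomic (.inr ⟨_, rfl⟩)

theorem atom_bot_le (G : PosetGame.{u, v} A) : Le (atom ⊥) G :=
  le_of_dual_le_dual (le_atom_top G.dual)

theorem tri_leftForcing (K G : PosetGame.{u, v} A) : Tri K (leftForcing G) :=
  .left (by simp [leftForcing, leftOptions_single]) (le_atom_top K)

theorem rightForcing_tri (G K : PosetGame.{u, v} A) : Tri (rightForcing G) K :=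
  .right (by simp [rightForcing, rightOptions_single]) (atom_bot_le K)

theorem le_leftForcing (h : Tri K G) : Le K (leftForcing G) :=
  .intro (fun _ _ => tri_leftForcing _ _) (forall_rightOptions_single.2 h)
    fun _ => tri_leftForcing _ _

theorem rightForcing_le (h : Tri G K) : Le (rightForcing G) K :=
  .intro (forall_leftOptions_single.2 h) (fun _ _ => rightForcing_tri _ _)
    fun _ => rightForcing_tri _ _

theorem choiceGadget_tri (h : Tri G G') :
    Tri (choiceGadget G H) (choiceGadget G' H') := by
  refine .left (H' := leftForcing G') (by simp [choiceGadget, leftOptions_pair]) ?_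
  refine le_leftForcing (.right (G' := rightForcing G) ?_ (rightForcing_le h))
  simp [choiceGadget, rightOptions_pair]

theorem couplingGadget_tri (h : Le G G' ∨ Le H H') :
    Tri (couplingGadget G H) (couplingGadget G' H') := by
  obtain hG | hH := h
  · refine .right (G' := rightForcing G) (by simp [couplingGadget, rightOptions_pair]) ?_
    exact rightForcing_le (.left (by simp [couplingGadget, leftOptions_pair]) hG)
  · refine .left (H' := leftForcing H') (by simp [couplingGadget, leftOptions_pair]) ?_
    exact le_leftForcing (.right (by simp [couplingGadget, rightOptions_pair]) hH)

theorem leftForcing_le_leftForcing (h : Le G G') : Le (leftForcing G) (leftForcing G') :=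
  single_le_single (.refl _) h

theorem rightForcing_le_rightForcing (h : Le G G') : Le (rightForcing G) (rightForcing G') :=
  single_le_single h (.refl _)

theorem choiceGadget_le_choiceGadget (hG : Le G G') (hH : Le H H') :
    Le (choiceGadget G H) (choiceGadget G' H') :=
  pair_le_pair (leftForcing_le_leftForcing hG) (leftForcing_le_leftForcing hH)
    (rightForcing_le_rightForcing hG) (rightForcing_le_rightForcing hH)

theorem couplingGadget_le_couplingGadget (hG : Le G G') (hH : Le H H') :
    Le (couplingGadget G H) (couplingGadget G' H') :=
  pair_le_pair hG (leftForcing_le_leftForcing hH) (rightForcing_le_rightForcing hG) hH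

theorem dual_choiceGadget (G H : PosetGame.{u, v} A) :
    (choiceGadget G H).dual = choiceGadget G.dual H.dual :=
  dual_pair ..

theorem choiceGadget_le_swap (G H : PosetGame.{u, v} A) :
    Le (choiceGadget G H) (choiceGadget H G) :=
  pair_le_pair_swap ..

theorem couplingGadget_dual_le (G H : PosetGame.{u, v} A) :
    Le (couplingGadget H.dual G.dual) (couplingGadget G H).dual := by
  rw [couplingGadget, couplingGadget, dual_pair]
  exact pair_le_pair_swap ..

end Gadgets

end PosetGame

namespace SetColoringGame

open PosetGame

section Position

variable {A : Type u} [PartialOrder A] {S T : SetColoringGame.{u, v} A} {p : S.Position}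
  {c : S.carrier}

theorem position_induction {motive : S.Position → Prop}
    (step : ∀ p, (∀ c b, p c = none → motive (S.color p c b)) → motive p) (p : S.Position) :
    motive p := by
  induction hn : {c | p c = none}.ncard using Nat.strong_induction_on generalizing p with
  | _ n ih => exact step p fun c b hc => ih _ (hn ▸ S.ncard_color_lt p c hc b) _ rfl

theorem color_self (p : S.Position) (c : S.carrier) (b : Bool) : S.color p c b c = some b := by
  simp only [color, Function.update_self]

theorem color_of_ne {c d : S.carrier} (h : d ≠ c) (p : S.Position) (b : Bool) :
    S.color p c b d = p d := by
  simp only [color, ne_eq, h, not_false_eq_true, Function.update_of_ne]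

theorem color_eq_none {c d : S.carrier} {b : Bool} :
    S.color p c b d = none ↔ d ≠ c ∧ p d = none := by
  rcases eq_or_ne d c with rfl | h
  · simp only [color_self, reduceCtorEq, ne_eq, not_true, false_and]
  · simp only [color_of_ne h, ne_eq, h, not_false_eq_true, true_and]

theorem sem_of_forall_ne_none (hp : ∀ c, p c ≠ none) :
    S.sem p = atom (S.payoff fun c => (p c).getD false) := by
  rw [sem, dif_neg fun ⟨c, hc⟩ => hp c hc]

theorem sem_of_nonempty {e : S.carrier → Prop} (he : ∀ c, e c ↔ p c = none)
    [Nonempty {c // e c}] :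
    S.sem p = comp {c // e c} {c // e c}
      (fun d => S.sem (S.color p d true)) (fun d => S.sem (S.color p d false)) := by
  obtain rfl : e = fun c => p c = none := funext fun c => propext (he c)
  rw [sem, dif_pos ‹_›]

theorem sem_of_eq_none (hc : p c = none) :
    haveI : Nonempty {c // p c = none} := ⟨c, hc⟩
    S.sem p = comp {c // p c = none} {c // p c = none}
      (fun d => S.sem (S.color p d true)) (fun d => S.sem (S.color p d false)) :=
  haveI : Nonempty {c // p c = none} := ⟨c, hc⟩
  sem_of_nonempty fun _ => .rfl

theorem isAtomic_sem : (S.sem p).IsAtomic ↔ ∀ c, p c ≠ none := by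
  refine ⟨fun ⟨a, ha⟩ c hc => ?_, fun hp => ⟨_, sem_of_forall_ne_none hp⟩⟩
  rw [sem_of_eq_none hc] at ha
  cases ha

theorem mem_leftOptions_sem {G : PosetGame.{u, v} A} :
    G ∈ (S.sem p).leftOptions ↔ ∃ c, p c = none ∧ S.sem (S.color p c true) = G := by
  by_cases h : ∃ c, p c = none
  · obtain ⟨c, hc⟩ := h
    rw [sem_of_eq_none hc]
    simp only [leftOptions, Set.mem_range, Subtype.exists, exists_prop]
  · rw [sem_of_forall_ne_none (not_exists.1 h)]
    exact iff_of_false nofun fun ⟨c, hc, _⟩ => h ⟨c, hc⟩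

theorem mem_rightOptions_sem {G : PosetGame.{u, v} A} :
    G ∈ (S.sem p).rightOptions ↔ ∃ c, p c = none ∧ S.sem (S.color p c false) = G := by
  by_cases h : ∃ c, p c = none
  · obtain ⟨c, hc⟩ := h
    rw [sem_of_eq_none hc]
    simp only [rightOptions, Set.mem_range, Subtype.exists, exists_prop]
  · rw [sem_of_forall_ne_none (not_exists.1 h)]
    exact iff_of_false nofun fun ⟨c, hc, _⟩ => h ⟨c, hc⟩

theorem tri_of_right_move {G : PosetGame.{u, v} A} (hc : p c = none)
    (h : Le (S.sem (S.color p c false)) G) : Tri (S.sem p) G :=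
  .right (mem_rightOptions_sem.2 ⟨c, hc, rfl⟩) h

theorem tri_of_left_move {G : PosetGame.{u, v} A} (hc : p c = none)
    (h : Le G (S.sem (S.color p c true))) : Tri G (S.sem p) :=
  .left (mem_leftOptions_sem.2 ⟨c, hc, rfl⟩) h

theorem sem_le_of_forall_left_move {G : PosetGame.{u, v} A}
    (left : ∀ c, p c = none → Tri (S.sem (S.color p c true)) G)
    (right : ∀ G' ∈ G.rightOptions, Tri (S.sem p) G')
    (atomic : (∀ c, p c ≠ none) ∨ G.IsAtomic → Tri (S.sem p) G) : Le (S.sem p) G := by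
  refine .intro (fun G' hG' => ?_) right (by rwa [isAtomic_sem])
  obtain ⟨c, hc, rfl⟩ := mem_leftOptions_sem.1 hG'
  exact left c hc

/-- The coloring `s` extends the position `p`. -/
def Completes (p : S.Position) (s : S.carrier → Bool) : Prop :=
  ∀ c b, p c = some b → s c = b

theorem Completes.of_color {b : Bool} {s : S.carrier → Bool} (h : Completes (S.color p c b) s)
    (hc : p c = none) : Completes p s := by
  intro d b' hd
  have hne : d ≠ c := fun h => Option.some_ne_none b' (hd.symm.trans (h ▸ hc))
  exact h d b' (by rwa [color_of_ne hne])

theorem Completes.apply_color {b : Bool} {s : S.carrier → Bool} (h : Completes (S.color p c b) s) :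
    s c = b :=
  h c b (color_self p c b)

theorem completes_getD (p : S.Position) : Completes p fun c => (p c).getD false :=
  fun _ _ hb => by simp only [hb, Option.getD_some]

/-- The order on the contents of a cell in which Right's color is least, Left's color is greatest
and an empty cell lies in between. -/
def CellLe (x y : Option Bool) : Prop := x = some false ∨ y = some true ∨ x = y

theorem sem_le_atom {x : A} (h : ∀ s, Completes p s → S.payoff s ≤ x) : Le (S.sem p) (atom x) := by
  induction p using position_induction with | step p ih
  have move {c} (b : Bool) (hc : p c = none) : Le (S.sem (S.color p c b)) (atom x) :=
    ih c b hc fun s hs => h s (hs.of_color hc)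
  refine sem_le_of_forall_left_move
    (fun c hc => (move true hc).tri_of_isAtomic (.inr ⟨x, rfl⟩)) nofun fun _ => ?_
  by_cases hp : ∃ c, p c = none
  · obtain ⟨c, hc⟩ := hp
    exact tri_of_right_move hc (move false hc)
  · rw [not_exists] at hp
    rw [sem_of_forall_ne_none hp]
    exact .atom (h _ (completes_getD p))

theorem sem_color_le_atom {x : A} {b : Bool} (hc : p c = none)
    (h : ∀ s, Completes p s → s c = b → S.payoff s ≤ x) : Le (S.sem (S.color p c b)) (atom x) :=
  sem_le_atom fun s hs => h s (hs.of_color hc) hs.apply_color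

theorem sem_le_atom_of_pairing {x : A} {d : S.carrier} (hc : p c = none) (hd : p d = none)
    (hcd : c ≠ d) (h : ∀ s, Completes p s → s c = false ∨ s d = false → S.payoff s ≤ x) :
    Le (S.sem p) (atom x) := by
  induction p using position_induction with | step p ih
  refine sem_le_of_forall_left_move (fun e he => ?_) nofun fun _ =>
    tri_of_right_move hc (sem_color_le_atom hc fun s hs hsc => h s hs (.inl hsc))
  by_cases hec : e = c
  · subst hec
    have hd' := color_eq_none (b := true).2 ⟨hcd.symm, hd⟩
    exact tri_of_right_move hd'
      (sem_color_le_atom hd' fun s hs hsd => h s (hs.of_color he) (.inr hsd))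
  by_cases hed : e = d
  · subst hed
    have hc' := color_eq_none (b := true).2 ⟨hcd, hc⟩
    exact tri_of_right_move hc'
      (sem_color_le_atom hc' fun s hs hsc => h s (hs.of_color he) (.inl hsc))
  · exact (ih e true he (color_eq_none.2 ⟨Ne.symm hec, hc⟩) (color_eq_none.2 ⟨Ne.symm hed, hd⟩)
      fun s hs => h s (hs.of_color he)).tri_of_isAtomic (.inr ⟨x, rfl⟩)

section Comparison

variable {f : T.carrier → S.carrier} {q : T.Position} {d : T.carrier} {b : Bool}

theorem cellLe_color_left (hpq : ∀ d, CellLe (p (f d)) (q d))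
    (hc : ∀ d, f d = c → CellLe (some b) (q d)) (d : T.carrier) :
    CellLe (S.color p c b (f d)) (q d) := by
  by_cases h : f d = c
  · rw [h, color_self]
    exact hc d h
  · rw [color_of_ne h]
    exact hpq d

theorem cellLe_color_right (hpq : ∀ d, CellLe (p (f d)) (q d)) (hd : CellLe (p (f d)) (some b))
    (d' : T.carrier) : CellLe (p (f d')) (T.color q d b d') := by
  rcases eq_or_ne d' d with rfl | h
  · rwa [color_self]
  · rw [color_of_ne h]
    exact hpq d'

theorem cellLe_color_color (hf : Function.Injective f) (hpq : ∀ d, CellLe (p (f d)) (q d))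
    (d' : T.carrier) : CellLe (S.color p (f d) b (f d')) (T.color q d b d') := by
  rcases eq_or_ne d' d with rfl | h
  · rw [color_self, color_self]
    exact .inr (.inr rfl)
  · rw [color_of_ne (hf.ne h), color_of_ne h]
    exact hpq d'

/-- Cells of `S` outside the range of `f` may be irrelevant to the payoff; a move in such a cell is
a pass, which never helps the player who makes it. -/
theorem sem_le_and_tri_sem (hf : Function.Injective f) (p : S.Position) (q : T.Position)
    (hpq : ∀ d, CellLe (p (f d)) (q d))
    (hpay : ∀ s t, Completes p s → Completes q t → (∀ d, s (f d) ≤ t d) →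
      S.payoff s ≤ T.payoff t) : Le (S.sem p) (T.sem q) ∧ Tri (S.sem p) (T.sem q) := by
  induction p using position_induction generalizing q with | step p ihp
  induction q using position_induction with | step q ihq
  have ihp' {c b} (hc : p c = none) (h : ∀ d, CellLe (S.color p c b (f d)) (q d)) :=
    ihp c b hc q h fun s t hs ht => hpay s t (hs.of_color hc) ht
  have ihq' {d b} (hd : q d = none) (h : ∀ d', CellLe (p (f d')) (T.color q d b d')) :=
    ihq d b hd h fun s t hs ht => hpay s t hs (ht.of_color hd)
  have ihpq {d} (b) (hp : p (f d) = none) (hq : q d = none) :=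
    ihp (f d) b hp (T.color q d b) (cellLe_color_color hf hpq)
      fun s t hs ht => hpay s t (hs.of_color hp) (ht.of_color hq)
  have tri : Tri (S.sem p) (T.sem q) := by
    by_cases hp : ∃ c, p c = none
    · obtain ⟨c, hc⟩ := hp
      exact tri_of_right_move hc (ihp' hc (cellLe_color_left hpq fun _ _ => .inl rfl)).1
    by_cases hq : ∃ d, q d = none
    · obtain ⟨d, hd⟩ := hq
      exact tri_of_left_move hd (ihq' hd (cellLe_color_right hpq (.inr (.inl rfl)))).1
    rw [not_exists] at hp hq
    rw [sem_of_forall_ne_none hp, sem_of_forall_ne_none hq]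
    refine .atom (hpay _ _ (completes_getD p) (completes_getD q) fun d => ?_)
    obtain h | h | h := hpq d <;> simp [h, Bool.le_true]
  refine ⟨sem_le_of_forall_left_move (fun c hc => ?_) (fun K hK => ?_) fun _ => tri, tri⟩
  · by_cases hcq : ∃ d, f d = c ∧ q d = none
    · obtain ⟨d, rfl, hd⟩ := hcq
      exact tri_of_left_move hd (ihpq true hc hd).1
    · refine (ihp' hc (cellLe_color_left hpq fun d hd => .inr (.inl ?_))).2
      obtain h | h | h := hpq d
      · simp [hd, hc] at h
      · exact h
      · exact absurd ⟨d, hd, h.symm.trans (hd ▸ hc)⟩ hcq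
  · obtain ⟨d, hd, rfl⟩ := mem_rightOptions_sem.1 hK
    obtain h | h | h := hpq d
    · exact (ihq' hd (cellLe_color_right hpq (.inl h))).2
    · simp [hd] at h
    · exact tri_of_right_move (h.trans hd) (ihpq false (h.trans hd) hd).1

open Classical in
theorem sem_comp_update_tri {Z : Type*} {a : S.carrier → Z} (ha : Function.Injective a)
    {z : Z → Option Bool} {i : Z} (hi : z i = none) :
    Tri (S.sem fun c => Function.update z i (some true) (a c)) (S.sem fun c => z (a c)) := by
  by_cases h : i ∈ Set.range a
  · obtain ⟨c, rfl⟩ := h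
    refine tri_of_left_move (c := c) hi (.of_eq (congrArg S.sem ?_))
    exact Function.update_comp_eq_of_injective z ha c (some true)
  · have hz : (fun c => Function.update z i (some true) (a c)) = fun c => z (a c) :=
      Function.update_comp_eq_of_notMem_range z (some true) h
    rw [hz]
    exact (sem_le_and_tri_sem Function.injective_id _ _ (fun _ => .inr (.inr rfl))
      fun s t _ _ hst => S.monotone_payoff hst).2

end Comparison

section Dual

/-- The dual set coloring game, with values in the opposite poset, in which the two players exchange
roles. -/
abbrev dual (S : SetColoringGame.{u, v} A) : SetColoringGame.{u, v} Aᵒᵈ where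
  carrier := S.carrier
  finite_carrier := S.finite_carrier
  payoff t := OrderDual.toDual (S.payoff fun c => !t c)
  monotone_payoff _ _ h := S.monotone_payoff fun c => compl_le_compl (h c)

theorem color_dual (p : S.Position) (c : S.carrier) (b : Bool) :
    S.dual.color (fun d => (p d).map not) c (!b) = fun d => (S.color p c b d).map not := by
  funext d
  rcases eq_or_ne d c with rfl | h
  · rw [color_self, color_self, Option.map_some]
  · rw [color_of_ne (S := S.dual) h, color_of_ne (S := S) h]

theorem sem_dual (p : S.Position) : S.dual.sem (fun c => (p c).map not) = (S.sem p).dual := by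
  induction p using position_induction with | step p ih
  by_cases h : ∃ c, p c = none
  · obtain ⟨c, hc⟩ := h
    have : Nonempty {d : S.dual.carrier // p d = none} := ⟨c, hc⟩
    rw [sem_of_eq_none hc, sem_of_nonempty (S := S.dual) (e := fun d => p d = none)
      fun _ => Option.map_eq_none_iff.symm]
    simp only [PosetGame.dual]
    congr! 2 with d d
    · rw [← ih _ _ d.2, ← color_dual p d.1 false, Bool.not_false]
    · rw [← ih _ _ d.2, ← color_dual p d.1 true, Bool.not_true]
  · rw [not_exists] at h
    rw [sem_of_forall_ne_none h, sem_of_forall_ne_none (by simpa using h)]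
    refine congrArg (fun t => atom (OrderDual.toDual (S.payoff t))) (funext fun c => ?_)
    obtain ⟨b, hb⟩ := Option.ne_none_iff_exists'.1 (h c)
    simp only [hb, Option.map_some, Option.getD_some, Bool.not_not]

theorem value_dual (S : SetColoringGame.{u, v} A) : S.dual.value = S.value.dual :=
  sem_dual fun _ => none

theorem realizableWithSize_of_le_of_dual_le {G : PosetGame.{u, v} A} (h : Le S.value G)
    (hdual : Le S.dual.value G.dual) : G.RealizableWithSize S.size :=
  ⟨S, rfl, le_of_dual_le_dual (value_dual S ▸ hdual), h⟩

end Dual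

end Position

section Control

/-- The function on `Bool × Bool` with value `top` at `⊤`, `x` at `(true, false)`, `y` at
`(false, true)` and `bot` at `⊥`. -/
def select {X : Type*} (top bot x y : X) : Bool × Bool → X
  | (true, true) => top
  | (true, false) => x
  | (false, true) => y
  | (false, false) => bot

theorem select_le_select {A : Type*} [PartialOrder A] [BoundedOrder A] {x x' y y' : A}
    {b b' : Bool × Bool} (hb : b ≤ b') (hx : x ≤ x') (hy : y ≤ y') :
    select ⊤ ⊥ x y b ≤ select ⊤ ⊥ x' y' b' := by
  match b, b' with
  | (false, false), _ => exact bot_le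
  | _, (true, true) => exact le_top
  | (true, false), (true, false) => exact hx
  | (false, true), (false, true) => exact hy
  | (true, true), (_, false) | (true, true), (false, _) | (_, true), (_, false)
  | (true, _), (false, _) => exact absurd hb (by simp [Prod.le_def])

variable {A : Type u} [PartialOrder A] [BoundedOrder A] {C : SetColoringGame.{0, v} (Bool × Bool)}
  {S T : SetColoringGame.{u, v} A} {Z : Type v} {a : S.carrier → Z} {b : T.carrier → Z}
  {z : Z → Option Bool} {i : Z}

/-- The games `S` and `T`, played on the cells `Z`, with the controls `C` deciding
which of them counts: the outcome of `C` being `(true, false)` selects `S`, and `(false, true)`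
selects `T`, whereas `⊤` and `⊥` are outright wins. -/
abbrev control [Finite Z] (C : SetColoringGame.{0, v} (Bool × Bool))
    (S T : SetColoringGame.{u, v} A) (a : S.carrier → Z) (b : T.carrier → Z) :
    SetColoringGame.{u, v} A where
  carrier := C.carrier ⊕ Z
  finite_carrier := haveI := C.finite_carrier; inferInstance
  payoff t := select ⊤ ⊥ (S.payoff fun c => t (.inr (a c))) (T.payoff fun c => t (.inr (b c)))
    (C.payoff fun c => t (.inl c))
  monotone_payoff _ _ h := select_le_select (C.monotone_payoff fun c => h (.inl c))
    (S.monotone_payoff fun c => h (.inr (a c))) (T.monotone_payoff fun c => h (.inr (b c)))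

/-- The game that remains to be played at the position `z` of the cells `Z` when the controls have
selected an outcome. -/
noncomputable def selected (S T : SetColoringGame.{u, v} A) (a : S.carrier → Z) (b : T.carrier → Z)
    (z : Z → Option Bool) : Bool × Bool → PosetGame.{u, v} A :=
  select (atom ⊤) (atom ⊥) (S.sem fun c => z (a c)) (T.sem fun c => z (b c))

theorem size_control [Finite Z] : (control C S T a b).size = C.size + Nat.card Z :=
  haveI := C.finite_carrier
  Nat.card_sum

open Classical in
/-- In each subgame of `P`, once games are substituted for the outcomes, Right has an answer to
every move of Left among the cells `Z`. -/
inductive Stable (S T : SetColoringGame.{u, v} A) (a : S.carrier → Z) (b : T.carrier → Z) :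
    PosetGame.{0, v} (Bool × Bool) → Prop
  | intro {P : PosetGame.{0, v} (Bool × Bool)} (left : ∀ P' ∈ P.leftOptions, Stable S T a b P')
      (right : ∀ P' ∈ P.rightOptions, Stable S T a b P')
      (answer : ∀ z i, z i = none →
        Tri (P.bind (selected S T a b (Function.update z i (some true))))
          (P.bind (selected S T a b z))) : Stable S T a b P

open Classical in
theorem selected_update_tri (ha : Function.Injective a) (hb : Function.Injective b)
    (hi : z i = none) (x : Bool × Bool) :
    Tri (selected S T a b (Function.update z i (some true)) x) (selected S T a b z x) := by
  match x with
  | (true, true) | (false, false) => exact .atom le_rfl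
  | (true, false) => exact sem_comp_update_tri ha hi
  | (false, true) => exact sem_comp_update_tri hb hi

open Classical in
theorem exists_of_mem_rightOptions_selected (ha : Function.Injective a)
    (hb : Function.Injective b) {x : Bool × Bool} {K : PosetGame.{u, v} A}
    (hK : K ∈ (selected S T a b z x).rightOptions) :
    ∃ i, z i = none ∧ selected S T a b (Function.update z i (some false)) x = K := by
  match x with
  | (true, true) | (false, false) => exact absurd hK (Set.notMem_empty _)
  | (true, false) =>
    obtain ⟨c, hc, rfl⟩ := mem_rightOptions_sem.1 hK
    refine ⟨a c, hc, congrArg S.sem ?_⟩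
    exact Function.update_comp_eq_of_injective z ha c (some false)
  | (false, true) =>
    obtain ⟨c, hc, rfl⟩ := mem_rightOptions_sem.1 hK
    refine ⟨b c, hc, congrArg T.sem ?_⟩
    exact Function.update_comp_eq_of_injective z hb c (some false)

theorem Stable.atom (ha : Function.Injective a) (hb : Function.Injective b) (x : Bool × Bool) :
    Stable S T a b (PosetGame.atom x) :=
  .intro nofun nofun fun _ _ hi => selected_update_tri ha hb hi x

variable [Finite Z]

open Classical in
theorem color_control_inl (p : C.Position) (z : Z → Option Bool) (c : C.carrier) (x : Bool) :
    (control C S T a b).color (Sum.elim p z) (.inl c) x = Sum.elim (C.color p c x) z :=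
  @Sum.update_elim_inl _ _ _ _ (_) _ _ _ _

open Classical in
theorem color_control_inr (p : C.Position) (z : Z → Option Bool) (i : Z) (x : Bool) :
    (control C S T a b).color (Sum.elim p z) (.inr i) x =
      Sum.elim p (Function.update z i (some x)) :=
  @Sum.update_elim_inr _ _ _ _ (_) _ _ _ _

theorem sem_control_le_and_tri_selected (ha : Function.Injective a) (hb : Function.Injective b)
    {p : C.Position} (hp : ∀ c, p c ≠ none) {x : Bool × Bool}
    (hx : C.payoff (fun c => (p c).getD false) ≤ x) (z : Z → Option Bool) :
    Le ((control C S T a b).sem (Sum.elim p z)) (selected S T a b z x) ∧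
      Tri ((control C S T a b).sem (Sum.elim p z)) (selected S T a b z x) := by
  have hpay s (hs : Completes (S := control C S T a b) (Sum.elim p z) s) :
      C.payoff (fun c => s (.inl c)) ≤ x := by
    refine le_of_eq_of_le (congrArg C.payoff (funext fun c => ?_)) hx
    obtain ⟨y, hy⟩ := Option.ne_none_iff_exists'.1 (hp c)
    rw [hy, hs (.inl c) y hy, Option.getD_some]
  match x with
  | (true, true) => exact ⟨le_atom_top _, (le_atom_top _).tri_of_isAtomic (.inr ⟨⊤, rfl⟩)⟩
  | (false, false) =>
    have h : Le ((control C S T a b).sem (Sum.elim p z)) (atom ⊥) :=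
      sem_le_atom fun s hs => select_le_select (hpay s hs) le_rfl le_rfl
    exact ⟨h, h.tri_of_isAtomic (.inr ⟨⊥, rfl⟩)⟩
  | (true, false) =>
    exact sem_le_and_tri_sem (Sum.inr_injective.comp ha) _ _ (fun _ => .inr (.inr rfl))
      fun s t hs _ hst => select_le_select (hpay s hs) (S.monotone_payoff hst) le_rfl
  | (false, true) =>
    exact sem_le_and_tri_sem (Sum.inr_injective.comp hb) _ _ (fun _ => .inr (.inr rfl))
      fun s t hs _ hst => select_le_select (hpay s hs) le_rfl (T.monotone_payoff hst)

theorem sem_control_le_and_tri (ha : Function.Injective a) (hb : Function.Injective b)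
    {P : PosetGame.{0, v} (Bool × Bool)} (hP : Stable S T a b P)
    (w : (control C S T a b).Position) :
    (Le (C.sem fun c => w (.inl c)) P →
      Le ((control C S T a b).sem w) (P.bind (selected S T a b fun i => w (.inr i)))) ∧
    (Tri (C.sem fun c => w (.inl c)) P →
      Tri ((control C S T a b).sem w) (P.bind (selected S T a b fun i => w (.inr i)))) := by
  classical
  induction hP generalizing w with | @intro P _ _ answer ihL ihR
  induction w using position_induction with | step w ih
  obtain ⟨p, z, rfl⟩ : ∃ p z, w = Sum.elim p z := ⟨_, _, (Sum.elim_comp_inl_inr w).symm⟩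
  have ih_inl c x hc := color_control_inl (a := a) (b := b) p z c x ▸ ih (.inl c) x hc
  have ih_inr i x hi := color_control_inr (a := a) (b := b) p z i x ▸ ih (.inr i) x hi
  have tri (h : Tri (C.sem p) P) :
      Tri ((control C S T a b).sem (Sum.elim p z)) (P.bind (selected S T a b z)) := by
    obtain ⟨G', hG', h⟩ | ⟨P', hP', h⟩ | ⟨x, y, hx, rfl, hxy⟩ := tri_iff.1 h
    · obtain ⟨c, hc, rfl⟩ := mem_rightOptions_sem.1 hG'
      refine tri_of_right_move (S := control C S T a b) (c := .inl c) hc ?_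
      rw [color_control_inl]
      exact (ih_inl c false hc).1 h
    · exact .left (mem_leftOptions_bind hP' _) ((ihL P' hP' _).1 h)
    · have hp := isAtomic_sem.1 ⟨x, hx⟩
      rw [sem_of_forall_ne_none hp] at hx
      cases hx
      exact (sem_control_le_and_tri_selected ha hb hp hxy z).2
  refine ⟨fun h => sem_le_of_forall_left_move ?_ ?_ ?_, tri⟩
  · rintro (c | i) hci
    · rw [color_control_inl]
      exact (ih_inl c true hci).2 (h.tri_left (mem_leftOptions_sem.2 ⟨c, hci, rfl⟩))
    · rw [color_control_inr]
      exact ((ih_inr i true hci).1 h).trans_tri (answer z i hci)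
  · intro K hK
    cases P with
    | atom x =>
      obtain ⟨i, hi, rfl⟩ := exists_of_mem_rightOptions_selected ha hb hK
      refine tri_of_right_move (S := control C S T a b) (c := .inr i) hi ?_
      rw [color_control_inr]
      exact (ih_inr i false hi).1 h
    | comp ι κ L R =>
      obtain ⟨j, rfl⟩ := hK
      exact (ihR _ ⟨j, rfl⟩ _).2 (h.tri_right ⟨j, rfl⟩)
  · refine fun hatomic => tri (h.tri_of_isAtomic (hatomic.imp (fun hw => ?_) fun hP => ?_))
    · exact isAtomic_sem.2 fun c => hw (.inl c)
    · cases P with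
      | atom x => exact ⟨x, rfl⟩
      | comp => exact absurd hP nofun

theorem value_control_le (ha : Function.Injective a) (hb : Function.Injective b)
    {P : PosetGame.{0, v} (Bool × Bool)} (hP : Stable S T a b P) (hC : Le C.value P) :
    Le (control C S T a b).value (P.bind (select (atom ⊤) (atom ⊥) S.value T.value)) :=
  (sem_control_le_and_tri ha hb hP fun _ => none).1 hC

end Control

section Realization

variable {A : Type u} [PartialOrder A] [BoundedOrder A]
  {C C' : SetColoringGame.{0, v} (Bool × Bool)} {S T : SetColoringGame.{u, v} A} {Z : Type v}
  {a : S.carrier → Z} {b : T.carrier → Z} {P P' Q : PosetGame.{0, v} (Bool × Bool)}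

theorem choiceGadget_bind_select (P Q : PosetGame.{0, v} (Bool × Bool)) (G H : PosetGame.{u, v} A) :
    (choiceGadget P Q).bind (select (atom ⊤) (atom ⊥) G H) =
      choiceGadget (P.bind (select (atom ⊤) (atom ⊥) G H))
        (Q.bind (select (atom ⊤) (atom ⊥) G H)) :=
  pair_bind ..

theorem couplingGadget_bind_select (P Q : PosetGame.{0, v} (Bool × Bool))
    (G H : PosetGame.{u, v} A) :
    (couplingGadget P Q).bind (select (atom ⊤) (atom ⊥) G H) =
      couplingGadget (P.bind (select (atom ⊤) (atom ⊥) G H))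
        (Q.bind (select (atom ⊤) (atom ⊥) G H)) :=
  pair_bind ..

theorem Stable.leftForcing (hP : Stable S T a b P)
    (ha : Function.Injective a) (hb : Function.Injective b) : Stable S T a b P.leftForcing :=
  .intro (forall_leftOptions_single.2 (.atom ha hb ⊤)) (forall_rightOptions_single.2 hP)
    fun _ _ _ => tri_leftForcing _ _

theorem Stable.rightForcing (hP : Stable S T a b P)
    (ha : Function.Injective a) (hb : Function.Injective b) : Stable S T a b P.rightForcing :=
  .intro (forall_leftOptions_single.2 hP) (forall_rightOptions_single.2 (.atom ha hb ⊥))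
    fun _ _ _ => rightForcing_tri _ _

theorem Stable.choiceGadget (hP : Stable S T a b P) (hQ : Stable S T a b Q)
    (ha : Function.Injective a) (hb : Function.Injective b) :
    Stable S T a b (PosetGame.choiceGadget P Q) := by
  refine .intro (forall_leftOptions_pair.2 ⟨hP.leftForcing ha hb, hQ.leftForcing ha hb⟩)
    (forall_rightOptions_pair.2 ⟨hP.rightForcing ha hb, hQ.rightForcing ha hb⟩) fun z i hi => ?_
  rw [selected, selected, choiceGadget_bind_select, choiceGadget_bind_select]
  cases hP with | intro _ _ answer => exact choiceGadget_tri (answer z i hi)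

theorem Stable.couplingGadget (ha : Function.Injective a) (hb : Function.Injective b)
    (hab : ∀ c d, a c ≠ b d) : Stable S T a b
      (PosetGame.couplingGadget (PosetGame.atom (true, false)) (PosetGame.atom (false, true))) := by
  classical
  have hG := Stable.atom (S := S) (T := T) ha hb (true, false)
  have hH := Stable.atom (S := S) (T := T) ha hb (false, true)
  refine .intro (forall_leftOptions_pair.2 ⟨hG, hH.leftForcing ha hb⟩)
    (forall_rightOptions_pair.2 ⟨hG.rightForcing ha hb, hH⟩) fun z i _ => ?_
  rw [selected, selected, couplingGadget_bind_select, couplingGadget_bind_select]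
  refine couplingGadget_tri ?_
  by_cases hib : i ∈ Set.range b
  · obtain ⟨d, rfl⟩ := hib
    refine .inl (Le.of_eq (congrArg S.sem ?_))
    exact Function.update_comp_eq_of_notMem_range z (some true) fun ⟨c, hc⟩ => hab c d hc
  · refine .inr (Le.of_eq (congrArg T.sem ?_))
    exact Function.update_comp_eq_of_notMem_range z (some true) hib

theorem toDual_select (x y : A) (o : Bool × Bool) :
    OrderDual.toDual (select ⊤ ⊥ x y o) =
      select ⊤ ⊥ (OrderDual.toDual y) (OrderDual.toDual x) oᶜ := by
  match o with
  | (true, true) | (true, false) | (false, true) | (false, false) => rfl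

theorem value_dual_control_le [Finite Z] {f : C'.carrier → C.carrier} (hf : Function.Injective f)
    (hC : ∀ s : C.carrier → Bool, (C.payoff fun c => !s c)ᶜ ≤ C'.payoff fun d => s (f d)) :
    Le (control C S T a b).dual.value (control C' T.dual S.dual b a).value := by
  refine (sem_le_and_tri_sem (f := Sum.map f id) (hf.sumMap Function.injective_id) _ _
    (fun _ => .inr (.inr rfl)) fun s t _ _ hst => ?_).1
  refine (toDual_select _ _ _).trans_le (select_le_select ?_ ?_ ?_)
  · exact (hC _).trans (C'.monotone_payoff fun d => hst (.inl d))
  · exact T.dual.monotone_payoff fun c => hst (.inr (b c))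
  · exact S.dual.monotone_payoff fun c => hst (.inr (a c))

theorem realizableWithSize_control [Finite Z]
    (ha : Function.Injective a) (hb : Function.Injective b)
    (hP : Stable S T a b P) (hC : Le C.value P)
    (hP' : Stable T.dual S.dual b a P') (hC' : Le C'.value P')
    {f : C'.carrier → C.carrier} (hf : Function.Injective f)
    (hCC' : ∀ s : C.carrier → Bool, (C.payoff fun c => !s c)ᶜ ≤ C'.payoff fun d => s (f d))
    (hPP' : Le (P'.bind (select (atom ⊤) (atom ⊥) T.value.dual S.value.dual))
      (P.bind (select (atom ⊤) (atom ⊥) S.value T.value)).dual) :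
    (P.bind (select (atom ⊤) (atom ⊥) S.value T.value)).RealizableWithSize
      (C.size + Nat.card Z) := by
  rw [← size_control (S := S) (T := T) (a := a) (b := b)]
  refine realizableWithSize_of_le_of_dual_le (value_control_le ha hb hP hC) ?_
  have hdual := value_control_le (S := T.dual) (T := S.dual) hb ha hP' hC'
  rw [value_dual, value_dual] at hdual
  exact (value_dual_control_le hf hCC').trans (hdual.trans hPP')

end Realization

section Controls

theorem sem_le_rightForcing {A : Type u} [PartialOrder A] [BoundedOrder A]
    {S : SetColoringGame.{u, v} A} {p : S.Position} {c : S.carrier} {x : A} (hc : p c = none)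
    (hx : ∀ s, Completes p s → S.payoff s ≤ x)
    (hbot : ∀ s, Completes p s → s c = false → S.payoff s ≤ ⊥) :
    Le (S.sem p) (rightForcing (atom x)) := by
  refine sem_le_of_forall_left_move (fun d hd => ?_) (forall_rightOptions_single.2 ?_) ?_
  · exact .left (by simp [rightForcing, leftOptions_single])
      (sem_le_atom fun s hs => hx s (hs.of_color hd))
  · exact tri_of_right_move hc (sem_color_le_atom hc hbot)
  · rintro (hp | h)
    · exact absurd hc (hp c)
    · exact absurd h (not_isAtomic_single _ _)

theorem sem_le_couplingGadget {S : SetColoringGame.{0, v} (Bool × Bool)} {p : S.Position}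
    {x y z : S.carrier} (hx : p x = none) (hy : p y = none) (hz : p z = none) (hxy : x ≠ y)
    (hxz : x ≠ z) (hyz : y ≠ z)
    (hpay : ∀ s, Completes p s → S.payoff s ≤ (s x, s y && s z)) :
    Le (S.sem p) (couplingGadget (atom (true, false)) (atom (false, true))) := by
  have tri {q : S.Position} (hq : q x = none) (hqp : ∀ s, Completes q s → Completes p s) :
      Tri (S.sem q) (atom (false, true)) :=
    tri_of_right_move hq <| sem_color_le_atom hq fun s hs hsx =>
      (hpay s (hqp s hs)).trans ⟨hsx.le, Bool.le_true _⟩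
  refine sem_le_of_forall_left_move (fun w hw => ?_) (forall_rightOptions_pair.2 ?_) ?_
  · by_cases hwx : w = x
    · subst hwx
      refine .left (H' := atom (true, false)) (by simp [couplingGadget, leftOptions_pair]) ?_
      refine sem_le_atom_of_pairing (color_eq_none.2 ⟨hxy.symm, hy⟩)
        (color_eq_none.2 ⟨hxz.symm, hz⟩) hyz fun s hs hyz => ?_
      exact (hpay s (hs.of_color hw)).trans ⟨Bool.le_true _, (Bool.and_eq_false_iff.2 hyz).le⟩
    · refine .left (H' := leftForcing (atom (false, true)))
        (by simp [couplingGadget, leftOptions_pair]) (le_leftForcing ?_)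
      exact tri (color_eq_none.2 ⟨Ne.symm hwx, hx⟩) fun s hs => hs.of_color hw
  · refine ⟨tri_of_right_move hy ?_, tri hx fun _ hs => hs⟩
    have hpay' s (hs : Completes (S.color p y false) s) : S.payoff s ≤ (s x, false) :=
      (hpay s (hs.of_color hy)).trans
        ⟨le_rfl, (Bool.and_eq_false_iff.2 (.inl hs.apply_color)).le⟩
    exact sem_le_rightForcing (color_eq_none.2 ⟨hxy, hx⟩)
      (fun s hs => (hpay' s hs).trans ⟨Bool.le_true _, le_rfl⟩)
      fun s hs hsx => (hpay' s hs).trans ⟨hsx.le, le_rfl⟩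
  · rintro (hp | h)
    · exact absurd hx (hp x)
    · exact absurd h (not_isAtomic_pair _ _ _ _)

/-- The controls for the left forcing gadget: a single cell. -/
abbrev leftControl : SetColoringGame.{0, v} (Bool × Bool) where
  carrier := PUnit
  finite_carrier := inferInstance
  payoff t := (true, t .unit)
  monotone_payoff _ _ h := ⟨le_rfl, h .unit⟩

/-- The controls for the right forcing gadget: a single cell. -/
abbrev rightControl : SetColoringGame.{0, v} (Bool × Bool) where
  carrier := PUnit
  finite_carrier := inferInstance
  payoff t := (false, t .unit)
  monotone_payoff _ _ h := ⟨le_rfl, h .unit⟩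

/-- The controls for the choice gadget: two cells, one for each component of the outcome. -/
abbrev choiceControl : SetColoringGame.{0, v} (Bool × Bool) where
  carrier := ULift Bool
  finite_carrier := inferInstance
  payoff t := (t ⟨false⟩, t ⟨true⟩)
  monotone_payoff _ _ h := ⟨h ⟨false⟩, h ⟨true⟩⟩

/-- The cells of `couplingControl`. -/
inductive CouplingCell : Type v
  | a | b | c | d | e
deriving DecidableEq

open CouplingCell

instance : Fintype CouplingCell.{v} where
  elems := {a, b, c, d, e}
  complete x := by cases x <;> decide

/-- The controls for the coupling gadget: the first component of the outcome goes to Left iff she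
gets both ends of an edge of the path `b – c – d – a`, and the second one iff she gets both ends
of an edge of the triangle `a – b – e`. -/
abbrev couplingControl : SetColoringGame.{0, v} (Bool × Bool) where
  carrier := CouplingCell
  finite_carrier := inferInstance
  payoff t := (t b && t c || t c && t d || t d && t a, t a && t b || t a && t e || t b && t e)
  monotone_payoff _ _ h :=
    ⟨sup_le_sup (sup_le_sup (inf_le_inf (h b) (h c)) (inf_le_inf (h c) (h d)))
      (inf_le_inf (h d) (h a)),
    sup_le_sup (sup_le_sup (inf_le_inf (h a) (h b)) (inf_le_inf (h a) (h e)))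
      (inf_le_inf (h b) (h e))⟩

theorem leftControl_value_le : Le leftControl.{v}.value (leftForcing (atom (true, false))) :=
  le_leftForcing <| tri_of_right_move (c := PUnit.unit) rfl <| sem_color_le_atom rfl
    fun _ _ hs => ⟨le_rfl, hs.le⟩

theorem rightControl_value_le :
    Le rightControl.{v}.value (rightForcing (atom (false, true))) :=
  sem_le_rightForcing (c := PUnit.unit) rfl (fun _ _ => ⟨le_rfl, Bool.le_true _⟩)
    fun _ _ hs => ⟨le_rfl, hs.le⟩

theorem choiceControl_value_le :
    Le choiceControl.{v}.value
      (choiceGadget (atom (true, false)) (atom (false, true))) := by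
  refine sem_le_of_forall_left_move ?_ (forall_rightOptions_pair.2 ?_) ?_
  · rintro ⟨_ | _⟩ -
    · refine .left (H' := leftForcing (atom (true, false)))
        (by simp [choiceGadget, leftOptions_pair]) (le_leftForcing ?_)
      refine tri_of_right_move (S := choiceControl) (c := ⟨true⟩)
        (color_eq_none.2 ⟨by simp, rfl⟩) ?_
      exact sem_le_atom fun s hs => ⟨Bool.le_true _, hs.apply_color.le⟩
    · refine .left (H' := leftForcing (atom (false, true)))
        (by simp [choiceGadget, leftOptions_pair]) (le_leftForcing ?_)
      refine tri_of_right_move (S := choiceControl) (c := ⟨false⟩)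
        (color_eq_none.2 ⟨by simp, rfl⟩) ?_
      exact sem_le_atom fun s hs => ⟨hs.apply_color.le, Bool.le_true _⟩
  · constructor
    · refine tri_of_right_move (S := choiceControl) (c := ⟨true⟩) rfl ?_
      exact sem_le_rightForcing (S := choiceControl) (c := ⟨false⟩) (color_eq_none.2 ⟨by simp, rfl⟩)
        (fun s hs => ⟨Bool.le_true _, hs.apply_color.le⟩)
        fun s hs h => ⟨h.le, hs.apply_color.le⟩
    · refine tri_of_right_move (S := choiceControl) (c := ⟨false⟩) rfl ?_
      exact sem_le_rightForcing (S := choiceControl) (c := ⟨true⟩) (color_eq_none.2 ⟨by simp, rfl⟩)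
        (fun s hs => ⟨hs.apply_color.le, Bool.le_true _⟩)
        fun s hs h => ⟨hs.apply_color.le, h.le⟩
  · rintro (h | h)
    · exact absurd rfl (h ⟨true⟩)
    · exact absurd h (not_isAtomic_pair _ _ _ _)

variable {p : couplingControl.{v}.Position}

theorem sem_couplingControl_tri_of_acd (ha : p a = none) (hc : p c = none) (hd : p d = none) :
    Tri (couplingControl.sem p) (atom (false, true)) := by
  refine tri_of_right_move hc (sem_le_atom_of_pairing (c := d) (d := a)
    (color_eq_none.2 ⟨nofun, hd⟩) (color_eq_none.2 ⟨nofun, ha⟩) nofun fun s hs h => ?_)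
  have hsc := hs.apply_color
  rcases h with h | h <;> simp [hsc, h, Bool.le_true]

theorem sem_couplingControl_tri_of_bcd (hb : p b = none) (hc : p c = none) (hd : p d = none) :
    Tri (couplingControl.sem p) (atom (false, true)) := by
  refine tri_of_right_move hd (sem_le_atom_of_pairing (c := c) (d := b)
    (color_eq_none.2 ⟨nofun, hc⟩) (color_eq_none.2 ⟨nofun, hb⟩) nofun fun s hs h => ?_)
  have hsd := hs.apply_color
  rcases h with h | h <;> simp [hsd, h, Bool.le_true]

theorem exists_right_reply_couplingControl {x : CouplingCell.{v}} (hx : x ≠ a) :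
    ∃ y z, (y ≠ x ∧ y ≠ a) ∧ (z ≠ y ∧ z ≠ x ∧ z ≠ a) ∧ ∀ s : CouplingCell.{v} → Bool,
      s a = false → s x = true → s y = false → couplingControl.payoff s ≤ (s z, false) := by
  cases x with
  | a => exact absurd rfl hx
  | b => exact ⟨e, c, by decide, by decide, fun s ha hb he => by
    cases hc : s c <;> simp [ha, hb, hc, he]⟩
  | c => exact ⟨b, d, by decide, by decide, fun s ha hc hb => by simp [ha, hb, hc]⟩
  | d => exact ⟨b, c, by decide, by decide, fun s ha hd hb => by simp [ha, hb, hd]⟩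
  | e => exact ⟨b, c, by decide, by decide, fun s ha _ hb => by simp [ha, hb, Bool.and_le_left]⟩

theorem value_couplingControl_tri_rightForcing :
    Tri couplingControl.{v}.value (rightForcing (atom (true, false))) := by
  refine tri_of_right_move (c := a) rfl ?_
  set p : couplingControl.{v}.Position := couplingControl.color (fun _ => none) a false
  have hp {x : CouplingCell} (hx : x ≠ a) : p x = none := color_eq_none.2 ⟨hx, rfl⟩
  have hb : p b = none := hp nofun
  refine sem_le_of_forall_left_move (fun x hx => ?_) (forall_rightOptions_single.2 ?_) ?_
  · have hxa : x ≠ a := (color_eq_none.1 hx).1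
    obtain ⟨y, z, ⟨hyx, hya⟩, ⟨hzy, hzx, hza⟩, h⟩ := exists_right_reply_couplingControl hxa
    have hy : couplingControl.color p x true y = none := color_eq_none.2 ⟨hyx, hp hya⟩
    have hpay s
        (hs : Completes (couplingControl.color (couplingControl.color p x true) y false) s) :
        couplingControl.payoff s ≤ (s z, false) :=
      have hs' := hs.of_color hy
      h s (hs'.of_color hx).apply_color hs'.apply_color hs.apply_color
    exact tri_of_right_move hy <| sem_le_rightForcing
      (color_eq_none.2 ⟨hzy, color_eq_none.2 ⟨hzx, hp hza⟩⟩)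
      (fun s hs => (hpay s hs).trans ⟨Bool.le_true _, le_rfl⟩)
      fun s hs hsz => (hpay s hs).trans ⟨hsz.le, le_rfl⟩
  · refine tri_of_right_move hb (sem_le_atom_of_pairing (c := c) (d := d)
      (color_eq_none.2 ⟨nofun, hp nofun⟩) (color_eq_none.2 ⟨nofun, hp nofun⟩) nofun
      fun s hs h => ?_)
    have hsa := (hs.of_color hb).apply_color
    have hsb := hs.apply_color
    have hbot : couplingControl.payoff s = (false, false) := by
      rcases h with h | h <;> simp [hsa, hsb, h]
    exact hbot.le
  · rintro (h | h)
    · exact absurd hb (h b)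
    · exact absurd h (not_isAtomic_single _ _)

theorem couplingControl_value_le :
    Le couplingControl.{v}.value (couplingGadget (atom (true, false)) (atom (false, true))) := by
  have empty {x y : CouplingCell.{v}} {i} (h : y ≠ x) :
      couplingControl.color (fun _ => none) x i y = none := color_eq_none.2 ⟨h, rfl⟩
  have left {K} (h : Tri K (atom (false, true))) :
      Tri K (couplingGadget (atom (true, false)) (atom (false, true))) :=
    .left (by simp [couplingGadget, leftOptions_pair]) (le_leftForcing h)
  refine sem_le_of_forall_left_move ?_ (forall_rightOptions_pair.2 ?_) ?_
  · rintro (_ | _ | _ | _ | _) -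
    · exact left (sem_couplingControl_tri_of_bcd (empty nofun) (empty nofun) (empty nofun))
    · exact left (sem_couplingControl_tri_of_acd (empty nofun) (empty nofun) (empty nofun))
    · have hb := empty (x := c) (y := b) (i := true) nofun
      refine tri_of_right_move hb (sem_le_couplingGadget (x := d) (y := a) (z := e)
        (color_eq_none.2 ⟨nofun, empty nofun⟩) (color_eq_none.2 ⟨nofun, empty nofun⟩)
        (color_eq_none.2 ⟨nofun, empty nofun⟩) nofun nofun nofun fun s hs => ?_)
      have hsb := hs.apply_color
      have hsc := (hs.of_color hb).apply_color
      cases hd : s d <;> simp [hsb, hsc, hd]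
    · have ha := empty (x := d) (y := a) (i := true) nofun
      refine tri_of_right_move ha (sem_le_couplingGadget (x := c) (y := b) (z := e)
        (color_eq_none.2 ⟨nofun, empty nofun⟩) (color_eq_none.2 ⟨nofun, empty nofun⟩)
        (color_eq_none.2 ⟨nofun, empty nofun⟩) nofun nofun nofun fun s hs => ?_)
      have hsa := hs.apply_color
      have hsd := (hs.of_color ha).apply_color
      cases hc : s c <;> simp [hsa, hsd, hc]
    · exact left (sem_couplingControl_tri_of_acd (empty nofun) (empty nofun) (empty nofun))
  · exact ⟨value_couplingControl_tri_rightForcing, sem_couplingControl_tri_of_acd rfl rfl rfl⟩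
  · rintro (h | h)
    · exact absurd rfl (h a)
    · exact absurd h (not_isAtomic_pair _ _ _ _)

end Controls

variable {A : Type u} [PartialOrder A] [BoundedOrder A] (S T : SetColoringGame.{u, v} A)

theorem realizableWithSize_leftForcing :
    (leftForcing S.value).RealizableWithSize (S.size + 1) := by
  have := S.finite_carrier
  have hid : Function.Injective (id : S.carrier → S.carrier) := Function.injective_id
  have hstable := Stable.atom (S := S) (T := S) hid hid
  have hstable' := Stable.atom (S := S.dual) (T := S.dual) hid hid
  have h : (leftForcing S.value).RealizableWithSize (leftControl.size + Nat.card S.carrier) :=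
    realizableWithSize_control (S := S) (T := S) (P := leftForcing (atom (true, false))) hid hid
      ((hstable _).leftForcing hid hid) leftControl_value_le
      ((hstable' _).rightForcing hid hid) rightControl_value_le
      Function.injective_id (fun s => ⟨le_rfl, (Bool.not_not _).le⟩) (.refl _)
  simpa [size, add_comm] using h

theorem realizableWithSize_rightForcing :
    (rightForcing S.value).RealizableWithSize (S.size + 1) := by
  have := S.finite_carrier
  have hid : Function.Injective (id : S.carrier → S.carrier) := Function.injective_id
  have hstable := Stable.atom (S := S) (T := S) hid hid
  have hstable' := Stable.atom (S := S.dual) (T := S.dual) hid hid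
  have h : (rightForcing S.value).RealizableWithSize (rightControl.size + Nat.card S.carrier) :=
    realizableWithSize_control (S := S) (T := S) (P := rightForcing (atom (false, true))) hid hid
      ((hstable _).rightForcing hid hid) rightControl_value_le
      ((hstable' _).leftForcing hid hid) leftControl_value_le
      Function.injective_id (fun s => ⟨le_rfl, (Bool.not_not _).le⟩) (.refl _)
  simpa [size, add_comm] using h

theorem realizableWithSize_choiceGadget :
    (choiceGadget S.value T.value).RealizableWithSize (max S.size T.size + 2) := by
  have := S.finite_carrier
  have := T.finite_carrier
  let a : S.carrier → ULift.{v} (Fin (max S.size T.size)) :=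
    fun c => ⟨Fin.castLE (le_max_left _ _) (Finite.equivFin S.carrier c)⟩
  let b : T.carrier → ULift.{v} (Fin (max S.size T.size)) :=
    fun c => ⟨Fin.castLE (le_max_right _ _) (Finite.equivFin T.carrier c)⟩
  have ha : Function.Injective a := ULift.up_injective.comp <|
    (Fin.castLE_injective _).comp (Finite.equivFin S.carrier).injective
  have hb : Function.Injective b := ULift.up_injective.comp <|
    (Fin.castLE_injective _).comp (Finite.equivFin T.carrier).injective
  have hstable := Stable.atom (S := S) (T := T) ha hb
  have hstable' := Stable.atom (S := T.dual) (T := S.dual) hb ha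
  have h := realizableWithSize_control (S := S) (T := T) ha hb
    ((hstable _).choiceGadget (hstable _) ha hb) choiceControl_value_le
    ((hstable' _).choiceGadget (hstable' _) hb ha) choiceControl_value_le
    Function.injective_id (fun s => ⟨(Bool.not_not _).le, (Bool.not_not _).le⟩) (by
      rw [choiceGadget_bind_select, choiceGadget_bind_select, dual_choiceGadget]
      exact choiceGadget_le_swap _ _)
  rw [choiceGadget_bind_select] at h
  simpa [size, add_comm, PosetGame.bind, select] using h

theorem realizableWithSize_couplingGadget :
    (couplingGadget S.value T.value).RealizableWithSize (S.size + T.size + 5) := by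
  have := S.finite_carrier
  have := T.finite_carrier
  have h := realizableWithSize_control (S := S) (T := T) Sum.inl_injective Sum.inr_injective
    (.couplingGadget Sum.inl_injective Sum.inr_injective nofun) couplingControl_value_le
    (.couplingGadget Sum.inr_injective Sum.inl_injective nofun) couplingControl_value_le
    (Equiv.swap CouplingCell.c CouplingCell.d).injective (by decide) (by
      rw [couplingGadget_bind_select, couplingGadget_bind_select]
      exact couplingGadget_dual_le _ _)
  rw [couplingGadget_bind_select] at h
  have hcard : Fintype.card CouplingCell.{v} = 5 := rfl
  simpa [size, hcard, add_comm, PosetGame.bind, select] using h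

end SetColoringGame

namespace PosetGame

variable {A : Type u} [PartialOrder A] {G H : PosetGame.{u, v} A}

theorem RealizableWithSize.of_equivalent {n : ℕ} (hH : H.RealizableWithSize n)
    (h : G.Equivalent H) : G.RealizableWithSize n := by
  obtain ⟨S, hS, hHS⟩ := hH
  exact ⟨S, hS, h.1.trans hHS.1, hHS.2.trans h.2⟩

end PosetGame

theorem proposition4p1 {A : Type u} [PartialOrder A] [BoundedOrder A]
    (G H : PosetGame.{u, v} A) (p q : ℕ)
    (hG : G.RealizableWithSize p) (hH : H.RealizableWithSize q) :
    ((PosetGame.leftForcing G).RealizableWithSize (p + 1) ∧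
      (PosetGame.rightForcing G).RealizableWithSize (p + 1)) ∧
    (PosetGame.choiceGadget G H).RealizableWithSize (max p q + 2) ∧
    (PosetGame.couplingGadget G H).RealizableWithSize (p + q + 5) := by
  obtain ⟨S, rfl, hGS, hSG⟩ := hG
  obtain ⟨T, rfl, hHT, hTH⟩ := hH
  refine ⟨⟨?_, ?_⟩, ?_, ?_⟩
  · exact S.realizableWithSize_leftForcing.of_equivalent
      ⟨PosetGame.leftForcing_le_leftForcing hGS, PosetGame.leftForcing_le_leftForcing hSG⟩
  · exact S.realizableWithSize_rightForcing.of_equivalent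
      ⟨PosetGame.rightForcing_le_rightForcing hGS, PosetGame.rightForcing_le_rightForcing hSG⟩
  · exact (S.realizableWithSize_choiceGadget T).of_equivalent
      ⟨PosetGame.choiceGadget_le_choiceGadget hGS hHT,
        PosetGame.choiceGadget_le_choiceGadget hSG hTH⟩
  · exact (S.realizableWithSize_couplingGadget T).of_equivalent
      ⟨PosetGame.couplingGadget_le_couplingGadget hGS hHT,
        PosetGame.couplingGadget_le_couplingGadget hSG hTH⟩
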